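/- Let $n\ge 1$. Consider $n$ players (machines) $0,1,\dots,n-1$ and $2(n-1)$ tasks $1,1',\dots,n-1,(n-1)'$ (the pairs $\{i,i'\}$ are the twin tasks). Fix a constant $\Theta>0$. The cost functions $v_j$, defined on sets of tasks, range over the following domain. Player $0$ (the $t$-player) has any cost function with $v_0(\emptyset)=0$ that is monotone, submodular on each pair $\{i,i'\}$, and additive across pairs, $v_0(S)=\sum_i v_0(S\cap\{i,i'\})$; write $t_i=v_0(\{i\})$, $t_{i'}=v_0(\{i'\})$, $t_{i,i'}=v_0(\{i,i'\})$. Player $i\ge 1$ has any nonnegative additive cost function whose cost is $\Theta$ for every task outside $\{i,i'\}$; write $s_i=v_i(\{i\})$, $s_{i'}=v_i(\{i'\})$. A mechanism consists of an allocation of every task to exactly one player and of a payment to each player, both functions of the reported cost functions. It is truthful if reporting the true cost function is a dominant strategy for each player, where utility is payment minus cost of the received tasks. It has approximation ratio less than $n$ if for some $c<n$ its makespan (the maximum over the players of the cost of the tasks received) is at most $c$ times the optimal makespan, on all instances of the domain. A restricted $(t,s)$ instance is one with $s_i\in[0,1]$, $s_{i'}=n$, $t_i\ge 0$, $t_{i'}=0$,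 $t_{i,i'}=t_i+t_{i'}$ for all $i=1,\dots,n-1$. Claim: if $\Theta$ is sufficiently large, depending only on $n$, then every truthful mechanism on the above domain with approximation ratio less than $n$ is linear on the restricted $(t,s)$ instances. That is, for each $i=1,\dots,n-1$ there are functions $\lambda_i(s_{-i},t_{-i})>0$ and $\gamma_i(s_{-i},t_{-i})\in\mathbb R$ such that, with $$\psi_i(s_i,s_{-i},t_{-i})=\max\bigl(0,\ \lambda_i(s_{-i},t_{-i})\,s_i+\gamma_i(s_{-i},t_{-i})\bigr),$$ on every restricted $(t,s)$ instance player $0$ receives task $i$ if $t_i<\psi_i(s_i,s_{-i},t_{-i})$, and does not receive task $i$ if $t_i>\psi_i(s_i,s_{-i},t_{-i})$. -/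

import Mathlib

/-! ### Scheduling on unrelated machines with private cost functions

`ι` is the set of machines (players), `τ` the set of tasks. -/

/-- A cost function: the cost of each set of tasks. -/
abbrev CostFun (τ : Type) : Type := Finset τ → ℝ

/-- A profile of cost functions (an input), one for each player. -/
abbrev Profile (ι τ : Type) : Type := ι → CostFun τ

/-- An allocation: every task is given to exactly one machine. -/
abbrev Allocation (ι τ : Type) : Type := τ → ι

/-- The set of tasks that the allocation `a` gives to machine `i`. -/
def bundle {ι τ : Type} [Fintype τ] [DecidableEq ι] (a : Allocation ι τ) (i : ι) : Finset τ :=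
  Finset.univ.filter fun x => a x = i

/-- The makespan of the allocation `a` on input `b`. -/
noncomputable def makespan {ι τ : Type} [Fintype ι] [Nonempty ι] [DecidableEq ι] [Fintype τ]
    (b : Profile ι τ) (a : Allocation ι τ) : ℝ :=
  Finset.univ.sup' Finset.univ_nonempty fun i => b i (bundle a i)

/-- The optimal makespan on input `b`, over all allocations. -/
noncomputable def optMakespan {ι τ : Type} [Fintype ι] [Nonempty ι] [DecidableEq ι]
    [Fintype τ] [DecidableEq τ] (b : Profile ι τ) : ℝ :=
  (Finset.univ : Finset (Allocation ι τ)).inf' Finset.univ_nonempty fun a => makespan b a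

/-- A direct revelation mechanism: an allocation algorithm and a payment scheme. Only its values
on the profiles of the domain under consideration are ever used. -/
structure Mechanism (ι τ : Type) where
  alloc : Profile ι τ → Allocation ι τ
  pay : Profile ι τ → ι → ℝ

/-- The profiles in which every player `i` has a cost function from her type space `D i`. -/
def InDomain {ι τ : Type} (D : ι → Set (CostFun τ)) (b : Profile ι τ) : Prop :=
  ∀ i, b i ∈ D i

/-- Utility of player `i` with true cost function `v` when the bids are `b`. -/
def Mechanism.utility {ι τ : Type} [DecidableEq ι] [Fintype τ] (M : Mechanism ι τ)
    (i : ι) (v : CostFun τ) (b : Profile ι τ) : ℝ :=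
  M.pay b i - v (bundle (M.alloc b) i)

/-- Truthfulness on the type spaces `D`: reporting the true type is a dominant strategy. -/
def Mechanism.IsTruthful {ι τ : Type} [DecidableEq ι] [Fintype τ]
    (D : ι → Set (CostFun τ)) (M : Mechanism ι τ) : Prop :=
  ∀ b : Profile ι τ, InDomain D b → ∀ i : ι, ∀ w ∈ D i,
    M.utility i (b i) (Function.update b i w) ≤ M.utility i (b i) b

/-- `M` is `c`-approximate on the type spaces `D`. -/
def Mechanism.IsApprox {ι τ : Type} [Fintype ι] [Nonempty ι] [DecidableEq ι]
    [Fintype τ] [DecidableEq τ]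
    (D : ι → Set (CostFun τ)) (c : ℝ) (M : Mechanism ι τ) : Prop :=
  ∀ b : Profile ι τ, InDomain D b → makespan b (M.alloc b) ≤ c * optMakespan b

/-! ### Cost functions -/

def CostFun.IsNormalized {τ : Type} (v : CostFun τ) : Prop := v ∅ = 0

def CostFun.IsMono {τ : Type} (v : CostFun τ) : Prop := ∀ S T : Finset τ, S ⊆ T → v S ≤ v T

/-- Additive cost functions, with nonnegative costs. -/
def CostFun.IsAdditive {τ : Type} (v : CostFun τ) : Prop :=
  (∀ x, 0 ≤ v {x}) ∧ ∀ S : Finset τ, v S = ∑ x ∈ S, v {x}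

/-- The restriction of `v` to the subsets of `U` is submodular. -/
def CostFun.IsSubmodularOn {τ : Type} [DecidableEq τ] (v : CostFun τ) (U : Finset τ) : Prop :=
  ∀ S T : Finset τ, S ⊆ U → T ⊆ U → v (S ∪ T) + v (S ∩ T) ≤ v S + v T

/-! ### The twin-task instances with `n` players -/

/-- The `2(n-1)` tasks: `(i, false)` is the task `i`, and `(i, true)` is its twin `i'`. -/
abbrev TwinTask (n : ℕ) : Type := Fin (n - 1) × Bool

/-- The `n` players: `none` is the `t`-player, `some i` is the `s`-player associated with the
`i`-th pair of twin tasks. -/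
abbrev TwinPlayer (n : ℕ) : Type := Option (Fin (n - 1))

/-- The `i`-th pair of twin tasks. -/
def twinPair {n : ℕ} (i : Fin (n - 1)) : Finset (TwinTask n) := {(i, false), (i, true)}

/-- The type spaces. The cost of the `t`-player is normalized, monotone, submodular on each pair of
twin tasks, and additive across pairs. The cost of an `s`-player is additive, and is the fixed
constant `Θ` for each task outside her pair. -/
def twinDomain (n : ℕ) (Θ : ℝ) : TwinPlayer n → Set (CostFun (TwinTask n))
  | none => {v | v.IsNormalized ∧ v.IsMono ∧ (∀ i, v.IsSubmodularOn (twinPair i)) ∧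
      ∀ S : Finset (TwinTask n), v S = ∑ i, v (S ∩ twinPair i)}
  | some i => {v | v.IsAdditive ∧ ∀ j, j ≠ i → v {(j, false)} = Θ ∧ v {(j, true)} = Θ}

/-- The restricted `(t, s)` instance: `s_{i'} = n`, `t_{i'} = 0`, and `t_{i,i'} = t_i + t_{i'}` for
all `i`. (The requirements `s_i ∈ [0,1]` and `t_i ≥ 0` are imposed where it is used.) -/
def restrictedInstance (n : ℕ) (Θ : ℝ) (t s : Fin (n - 1) → ℝ) :
    Profile (TwinPlayer n) (TwinTask n)
  | none => fun S => ∑ x ∈ S, if x.2 then 0 else t x.1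
  | some i => fun S => ∑ x ∈ S, if x.1 = i then (if x.2 then (n : ℝ) else s i) else Θ

/-- A vector without its `i`-th coordinate. -/
def dropCoord {m : ℕ} (i : Fin m) (x : Fin m → ℝ) : {j : Fin m // j ≠ i} → ℝ := fun j => x j

/-- `ψ (s_i, s_{-i}, t_{-i})` is a critical value for task `i`: on the restricted `(t, s)` instances
the `t`-player receives task `i` when `t_i < ψ`, and does not receive it when `t_i > ψ`. -/
def IsCriticalValue (n : ℕ) (Θ : ℝ)
    (A : Profile (TwinPlayer n) (TwinTask n) → Allocation (TwinPlayer n) (TwinTask n))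
    (i : Fin (n - 1))
    (ψ : ℝ → ({j : Fin (n - 1) // j ≠ i} → ℝ) → ({j : Fin (n - 1) // j ≠ i} → ℝ) → ℝ) : Prop :=
  ∀ t s : Fin (n - 1) → ℝ, (∀ j, 0 ≤ t j) → (∀ j, s j ∈ Set.Icc (0 : ℝ) 1) →
    (t i < ψ (s i) (dropCoord i s) (dropCoord i t) →
      A (restrictedInstance n Θ t s) (i, false) = none) ∧
    (ψ (s i) (dropCoord i s) (dropCoord i t) < t i →
      A (restrictedInstance n Θ t s) (i, false) ≠ none)

/-- Linear allocation algorithms for the restricted `(t, s)` instances: the critical value for each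
task `i` is `max(0, λ_i s_i + γ_i)`, where `λ_i > 0` and `γ_i` are functions of `(s_{-i}, t_{-i})`. -/
def IsLinearAlloc (n : ℕ) (Θ : ℝ)
    (A : Profile (TwinPlayer n) (TwinTask n) → Allocation (TwinPlayer n) (TwinTask n)) : Prop :=
  ∀ i : Fin (n - 1),
    ∃ lam gam : ({j : Fin (n - 1) // j ≠ i} → ℝ) → ({j : Fin (n - 1) // j ≠ i} → ℝ) → ℝ,
      (∀ σ ρ, 0 < lam σ ρ) ∧
      IsCriticalValue n Θ A i fun x σ ρ => max 0 (lam σ ρ * x + gam σ ρ)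

/-! Fix everything outside one pair. For large `Θ` the approximation bound stops each leaf from
taking tasks of other pairs, so what remains is a truthful mechanism for the root and one leaf with
costs `(x, b)` on two tasks (`pairMechanism`). When `b > c * max 1 x`, a cheap twin must go to the
root. Let `D` be the critical extra cost of the first task given the twin, and `E` the critical cost
of the twin when the first task is too expensive.

Three families of root costs isolate three bundle choices. With `(y, 0, y)` only the first task is
in question, so truthfulness of the leaf makes `D` monotone in `x` alone. With `(L, e, L)` only the
twin is, so `E` is monotone in `b` alone. With the submodular cost `(y, y, y)` the root takes both
or none, so where `D > 0` the sum `D + E` is monotone in `x + b`. Hence an increment of `D` in `x`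
and one of `E` in `b` are ordered by the lengths of their intervals, wherever these lie
(`incrementComparison`).

Packing many short intervals into the range of `b` shows that `D` is continuous. Comparing two
increments of `D` through `E` shows that equal lengths give equal increments where `D > 0`, so `D`
is affine there (`IncrementComparison.affine`). The approximation ratio makes the slope positive:
`D` is at most `c` for `x ≤ 1` and at least `n` at `x = n ^ 2`. -/

/-! ### Continuous solutions of the midpoint equation -/

theorem nonpos_of_reflection_symmetric {w : ℝ → ℝ} {p q : ℝ} (hpq : p ≤ q)
    (hw : ContinuousOn w (Set.Icc p q)) (hp : w p = 0) (hq : w q = 0)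
    (hmid : ∀ x h, 0 ≤ h → p ≤ x - h → x + h ≤ q → w (x + h) + w (x - h) = 2 * w x) :
    ∀ x ∈ Set.Icc p q, w x ≤ 0 := by
  obtain ⟨z, ⟨hz1, hz2⟩, hz⟩ :=
    isCompact_Icc.exists_isMaxOn (Set.nonempty_Icc.2 hpq) hw
  have hmax : ∀ x, p ≤ x → x ≤ q → w x ≤ w z := fun x h1 h2 => hz ⟨h1, h2⟩
  -- Reflect the endpoint nearer to the maximizer `z` in `z`: the two values average to `w z`, one
  -- is `0` and the other is at most `w z`.
  have hz0 : w z ≤ 0 := by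
    rcases le_total (z - p) (q - z) with h | h
    · have h1 := hmid z (z - p) (by linarith) (by linarith) (by linarith)
      have h2 := hmax (z + (z - p)) (by linarith) (by linarith)
      rw [show z - (z - p) = p by ring, hp] at h1
      linarith
    · have h1 := hmid z (q - z) (by linarith) (by linarith) (by linarith)
      have h2 := hmax (z - (q - z)) (by linarith) (by linarith)
      rw [show z + (q - z) = q by ring, hq] at h1
      linarith
  exact fun x hx => (hz hx).trans hz0

theorem eq_zero_of_reflection_symmetric {w : ℝ → ℝ} {p q : ℝ} (hpq : p ≤ q)
    (hw : ContinuousOn w (Set.Icc p q)) (hp : w p = 0) (hq : w q = 0)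
    (hmid : ∀ x h, 0 ≤ h → p ≤ x - h → x + h ≤ q → w (x + h) + w (x - h) = 2 * w x)
    {x : ℝ} (hx : x ∈ Set.Icc p q) : w x = 0 := by
  refine le_antisymm (nonpos_of_reflection_symmetric hpq hw hp hq hmid x hx) ?_
  have := nonpos_of_reflection_symmetric (w := fun y => - w y) hpq hw.neg (by simp [hp])
    (by simp [hq]) (fun y h h0 h1 h2 => by have := hmid y h h0 h1 h2; linarith) x hx
  linarith

/-! ### Comparable increments force affinity -/

/-- Two monotone functions whose increments over intervals of different lengths are comparable;
the lower bound on the increments of `d` is only available where `d` is positive. -/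
structure IncrementComparison (d e : ℝ → ℝ) (A B B' : ℝ) : Prop where
  pos : 0 < A
  wide : B + A < B'
  mono_left : ∀ x y, 0 < x → x < y → y < A → d x ≤ d y
  le_incr : ∀ x y a h, 0 < x → x < y → y < A → B < a → a + h < B' → y - x < h →
    d y - d x ≤ e (a + h) - e a
  incr_le : ∀ x y a h, 0 < x → y < A → 0 < d x → B < a → a + h < B' → 0 < h → h < y - x →
    e (a + h) - e a ≤ d y - d x

namespace IncrementComparison

variable {d e : ℝ → ℝ} {A B B' : ℝ}

/-- A window of length `A` inside `(B, B')` splits into `M` intervals of length `A / M`. The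
increment of `e` over each dominates any increment of `d` over a shorter interval, so the latter is
at most a fixed total divided by `M`. -/
theorem exists_modulus (H : IncrementComparison d e A B B') {η : ℝ} (hη : 0 < η) :
    ∃ δ > 0, ∀ x y, 0 < x → x < y → y < A → y - x < δ → d y - d x ≤ η := by
  have hA := H.pos
  have hw := H.wide
  obtain ⟨b₁, hb₁, hb₁'⟩ : ∃ b₁, B < b₁ ∧ b₁ + A < B' :=
    ⟨B + (B' - B - A) / 2, by linarith, by linarith⟩
  obtain ⟨N, hN⟩ := exists_nat_gt ((e (b₁ + A) - e b₁) / η)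
  set M : ℕ := N + 1
  have hM : (0 : ℝ) < M := by positivity
  refine ⟨A / M, by positivity, fun x y hx hxy hy hlt => ?_⟩
  have key : ∀ k : ℕ, k ≤ M → k * (d y - d x) ≤ e (b₁ + k * (A / M)) - e b₁ := by
    intro k
    induction k with
    | zero => intro _; simp
    | succ k ih =>
      intro hk
      have h1 := ih (by omega)
      have hk' : ((k : ℝ) + 1) * (A / M) ≤ A := by
        have : ((k : ℝ) + 1) ≤ M := by exact_mod_cast hk
        calc ((k : ℝ) + 1) * (A / M) ≤ M * (A / M) := by gcongr
          _ = A := by field_simp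
      have h0 : 0 ≤ (k : ℝ) * (A / M) := by positivity
      have h2 := H.le_incr x y (b₁ + k * (A / M)) (A / M) hx hxy hy (by linarith)
        (by linarith) hlt
      push_cast
      rw [show b₁ + ((k : ℝ) + 1) * (A / M) = b₁ + k * (A / M) + A / M by ring]
      linarith
  have h := key M le_rfl
  rw [show b₁ + (M : ℝ) * (A / M) = b₁ + A by field_simp] at h
  rw [div_lt_iff₀ hη] at hN
  have hMN : (M : ℝ) = N + 1 := by simp [M]
  by_contra hcon
  push Not at hcon
  have : (M : ℝ) * η < M * (d y - d x) := by gcongr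
  nlinarith

theorem continuousOn (H : IncrementComparison d e A B B') {p q : ℝ} (hp : 0 < p) (hq : q < A) :
    ContinuousOn d (Set.Icc p q) := by
  rw [Metric.continuousOn_iff]
  intro y hy η hη
  obtain ⟨δ, hδ, h⟩ := H.exists_modulus (half_pos hη)
  refine ⟨δ, hδ, fun x hx hxy => ?_⟩
  rw [Real.dist_eq] at hxy ⊢
  obtain ⟨h1, h2⟩ := abs_lt.1 hxy
  obtain ⟨hx1, hx2⟩ := hx
  obtain ⟨hy1, hy2⟩ := hy
  rcases lt_trichotomy x y with hlt | rfl | hlt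
  · have := h x y (by linarith) hlt (by linarith) (by linarith)
    have := H.mono_left x y (by linarith) hlt (by linarith)
    rw [abs_lt]; constructor <;> linarith
  · simpa using hη
  · have := h y x (by linarith) hlt (by linarith) (by linarith)
    have := H.mono_left y x (by linarith) hlt (by linarith)
    rw [abs_lt]; constructor <;> linarith

/-- Both increments of `d` are compared with one increment of `e`. The comparisons need strict
inequalities of length, so `y` is first moved down by `ε`, at a cost bounded by the modulus of
continuity. -/
theorem incr_mono (H : IncrementComparison d e A B B') {x y x' y' : ℝ} (hx : 0 < x) (hxy : x < y)
    (hy : y < A) (hx' : 0 < x') (hy' : y' < A) (hd : 0 < d x') (hle : y - x ≤ y' - x') :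
    d y - d x ≤ d y' - d x' := by
  refine le_of_forall_pos_le_add fun η hη => ?_
  obtain ⟨δ, hδ, h⟩ := H.exists_modulus hη
  have hw := H.wide
  obtain ⟨ε, hε, hε1, hε2⟩ : ∃ ε > 0, ε < δ ∧ ε < y - x := by
    obtain ⟨ε, h1, h2⟩ := exists_between (lt_min hδ (sub_pos.2 hxy))
    exact ⟨ε, h1, (lt_min_iff.1 h2).1, (lt_min_iff.1 h2).2⟩
  have h1 := h (y - ε) y (by linarith) (by linarith) hy (by linarith)
  have h2 := H.le_incr x (y - ε) (B + (B' - B - A) / 2) (y - x - ε / 2) hx (by linarith)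
    (by linarith) (by linarith) (by linarith) (by linarith)
  have h3 := H.incr_le x' y' (B + (B' - B - A) / 2) (y - x - ε / 2) hx' hy' hd
    (by linarith) (by linarith) (by linarith) (by linarith)
  linarith

/-- By `incr_mono` in both directions, adjacent intervals of equal length carry equal increments.
The difference from the chord is therefore continuous, satisfies the midpoint equation and vanishes
at the endpoints. -/
theorem affine (H : IncrementComparison d e A B B') {p q x : ℝ} (hp : 0 < p) (hpq : p < q)
    (hq : q < A) (hd : 0 < d p) (hx : x ∈ Set.Icc p q) :
    d x = d p + (d q - d p) / (q - p) * (x - p) := by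
  have hpos : ∀ y, p ≤ y → y < A → 0 < d y := by
    intro y h1 h2
    rcases h1.eq_or_lt with rfl | h1
    · exact hd
    · exact hd.trans_le (H.mono_left p y hp h1 h2)
  have hqp : q - p ≠ 0 := by linarith
  have := eq_zero_of_reflection_symmetric
    (w := fun y => d y - (d p + (d q - d p) / (q - p) * (y - p))) hpq.le
    ((H.continuousOn hp hq).sub (by fun_prop)) (by simp) (by field_simp; ring) ?_ hx
  · linarith
  · intro y h h0 h1 h2
    rcases h0.eq_or_lt with rfl | h0
    · simp; ring
    · have e1 := H.incr_mono (x := y - h) (y := y) (x' := y) (y' := y + h) (by linarith)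
        (by linarith) (by linarith) (by linarith) (by linarith)
        (hpos y (by linarith) (by linarith)) (by linarith)
      have e2 := H.incr_mono (x := y) (y := y + h) (x' := y - h) (y' := y) (by linarith)
        (by linarith) (by linarith) (by linarith) (by linarith)
        (hpos _ (by linarith) (by linarith)) (by linarith)
      have e3 : d (y + h) + d (y - h) = 2 * d y := by linarith
      linear_combination e3

end IncrementComparison

/-! ### Critical values of a pair are truncated affine -/

/-- The inputs `(x, b)` of the player associated with a pair at which the `t`-player always
receives the twin task when it is cheap for her. -/
def TwinForced (c A K x b : ℝ) : Prop :=
  0 ≤ x ∧ x ≤ A ∧ b ≤ K ∧ c < b ∧ c * x < b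

/-- The critical values `D` (both tasks versus the twin task only), `E` (the twin task only versus
no task), and their monotonicity. -/
structure CriticalValues (n c A K : ℝ) (D E : ℝ → ℝ → ℝ) : Prop where
  nonneg : ∀ x b, TwinForced c A K x b → 0 ≤ D x b
  mono_fst : ∀ x b y b', TwinForced c A K x b → TwinForced c A K y b' → x < y → D x b ≤ D y b'
  mono_snd : ∀ x b y b', TwinForced c A K x b → TwinForced c A K y b' → b < b' → E x b ≤ E y b'
  mono_add : ∀ x b y b', TwinForced c A K x b → TwinForced c A K y b' → 0 < D x b →
    x + b < y + b' → D x b + E x b ≤ D y b' + E y b'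
  lower : ∀ x b z, TwinForced c A K x b → 1 ≤ z → c * z < x → z ≤ D x b
  upper : ∀ x b, TwinForced c A K x b → x ≤ 1 → D x b ≤ c

namespace CriticalValues

variable {n c A K : ℝ} {D E : ℝ → ℝ → ℝ}

/-- For `b ≥ n * A` every `x ≤ A` satisfies `c * x < b`, and `K` leaves a range of length `2 * A`
for `b`. The increments come from `mono_add` at two points shifted by `ε`, since all monotonicity
statements need strict inequalities. -/
theorem incrementComparison (H : CriticalValues n c A K D E) (hc : 1 ≤ c) (hcn : c < n)
    (hA : 1 ≤ A) (hK : K = (n + 2) * A) :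
    IncrementComparison (fun x => D x K) (fun b => E 0 b) A (n * A) K := by
  have hU : ∀ x b, 0 ≤ x → x ≤ A → n * A ≤ b → b ≤ K → TwinForced c A K x b := by
    intro x b h1 h2 h3 h4
    refine ⟨h1, h2, h4, ?_, ?_⟩ <;> nlinarith
  have hKA : K = n * A + 2 * A := by rw [hK]; ring
  refine ⟨by linarith, by linarith, ?_, ?_, ?_⟩
  · intro x y hx hxy hy
    exact H.mono_fst _ _ _ _ (hU _ _ (by linarith) (by linarith) (by linarith) (by linarith))
      (hU _ _ (by linarith) (by linarith) (by linarith) (by linarith)) hxy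
  · intro x y a h hx hxy hy ha hah hlt
    obtain ⟨ε, hε, hε'⟩ : ∃ ε > 0, ε < min (min x (A - y)) ((h - (y - x)) / 4) :=
      exists_between (lt_min (lt_min hx (by linarith)) (by linarith))
    simp only [lt_min_iff] at hε'
    obtain ⟨⟨e1, e2⟩, e3⟩ := hε'
    have u1 := hU y K (by linarith) (by linarith) (by linarith) (by linarith)
    have u2 := hU x K (by linarith) (by linarith) (by linarith) (by linarith)
    have u3 := hU (y + ε) (a + ε) (by linarith) (by linarith) (by linarith) (by linarith)
    have u4 := hU (x - ε) (a + h - ε) (by linarith) (by linarith) (by linarith) (by linarith)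
    have u5 := hU 0 a (by linarith) (by linarith) (by linarith) (by linarith)
    have u6 := hU 0 (a + h) (by linarith) (by linarith) (by linarith) (by linarith)
    have m1 := H.mono_fst _ _ _ _ u1 u3 (by linarith)
    have m2 := H.mono_fst _ _ _ _ u4 u2 (by linarith)
    have m3 := H.mono_snd _ _ _ _ u5 u3 (by linarith)
    have m4 := H.mono_snd _ _ _ _ u4 u6 (by linarith)
    -- If `D` vanishes at the shifted point, `mono_add` is not available, but then `D y K = 0` and
    -- monotonicity of `E` suffices.
    rcases (H.nonneg _ _ u3).eq_or_lt with h0 | h0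
    · have m5 := H.mono_snd _ _ _ _ u5 u6 (by linarith)
      have m6 := H.nonneg _ _ u2
      linarith
    · have m5 := H.mono_add _ _ _ _ u3 u4 h0 (by linarith)
      linarith
  · intro x y a h hx hy hd ha hah h0 hlt
    obtain ⟨ε, hε, hε'⟩ : ∃ ε > 0, ε < min (min (a - n * A) (K - (a + h))) ((y - x - h) / 4) :=
      exists_between (lt_min (lt_min (by linarith) (by linarith)) (by linarith))
    simp only [lt_min_iff] at hε'
    obtain ⟨⟨e1, e2⟩, e3⟩ := hε'
    have u1 := hU y K (by linarith) (by linarith) (by linarith) (by linarith)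
    have u2 := hU x K (by linarith) (by linarith) (by linarith) (by linarith)
    have u3 := hU (x + ε) (a + h + ε) (by linarith) (by linarith) (by linarith) (by linarith)
    have u4 := hU (y - ε) (a - ε) (by linarith) (by linarith) (by linarith) (by linarith)
    have u5 := hU 0 a (by linarith) (by linarith) (by linarith) (by linarith)
    have u6 := hU 0 (a + h) (by linarith) (by linarith) (by linarith) (by linarith)
    have m1 := H.mono_fst _ _ _ _ u2 u3 (by linarith)
    have m2 := H.mono_fst _ _ _ _ u4 u1 (by linarith)
    have m3 := H.mono_snd _ _ _ _ u4 u5 (by linarith)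
    have m4 := H.mono_snd _ _ _ _ u6 u3 (by linarith)
    have m5 := H.mono_add _ _ _ _ u3 u4 (by linarith) (by linarith)
    linarith

/-- Since `mono_fst` allows different second arguments, `D x b` lies between `D (x - ε) K` and `D (x
+ ε) K`, and `D · K` is continuous. -/
theorem eq_of_interior (H : CriticalValues n c A K D E) (hc : 1 ≤ c) (hcn : c < n)
    (hA : 1 ≤ A) (hK : K = (n + 2) * A) {x b : ℝ} (hx : 0 < x) (hxA : x < A)
    (hU : TwinForced c A K x b) : D x b = D x K := by
  have hU' : ∀ y, 0 ≤ y → y ≤ A → TwinForced c A K y K := by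
    intro y h1 h2
    refine ⟨h1, h2, le_rfl, ?_, ?_⟩ <;> rw [hK] <;> nlinarith
  have I := H.incrementComparison hc hcn hA hK
  have key : ∀ η > 0, |D x b - D x K| ≤ η := by
    intro η hη
    obtain ⟨δ, hδ, h⟩ := I.exists_modulus hη
    obtain ⟨ε, hε, hε'⟩ : ∃ ε > 0, ε < min δ (min x (A - x)) :=
      exists_between (lt_min hδ (lt_min hx (by linarith)))
    simp only [lt_min_iff] at hε'
    obtain ⟨e1, e2, e3⟩ := hε'
    have m1 := h (x - ε) x (by linarith) (by linarith) hxA (by linarith)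
    have m2 := h x (x + ε) (by linarith) (by linarith) (by linarith) (by linarith)
    have m3 := H.mono_fst _ _ _ _ (hU' (x - ε) (by linarith) (by linarith)) hU (by linarith)
    have m4 := H.mono_fst _ _ _ _ hU (hU' (x + ε) (by linarith) (by linarith)) (by linarith)
    rw [abs_le]; constructor <;> linarith
  have h0 : |D x b - D x K| ≤ 0 :=
    le_of_forall_pos_le_add fun η hη => (key η hη).trans (zero_add η).ge
  linarith [abs_nonpos_iff.1 h0]

/-- The point `n ^ 2`, which lies below `A`, anchors the chords: there `D ≥ n` because `c * n < n ^
2`, while `D ≤ c` on `(0, 1]`. This gives a positive slope. -/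
theorem exists_affine_interior (H : CriticalValues n c A K D E) (hc : 1 ≤ c) (hcn : c < n)
    (hA : A = n ^ 2 + 1) (hK : K = (n + 2) * A) :
    ∃ lam gam : ℝ, 0 < lam ∧ ∀ x, 0 < x → x ≤ 1 → D x K = max 0 (lam * x + gam) := by
  have hA1 : 1 ≤ A := by nlinarith
  have hU' : ∀ y, 0 ≤ y → y ≤ A → TwinForced c A K y K := by
    intro y h1 h2
    refine ⟨h1, h2, le_rfl, ?_, ?_⟩ <;> rw [hK] <;> nlinarith
  have I := H.incrementComparison hc hcn hA1 hK
  have hn2 : 1 < n ^ 2 := by nlinarith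
  have hnA : n ^ 2 < A := by linarith
  by_cases hex : ∃ p, 0 < p ∧ p ≤ 1 ∧ 0 < D p K
  · obtain ⟨p, hp, hp1, hdp⟩ := hex
    have hup := H.upper p K (hU' p hp.le (by linarith)) hp1
    have hlow := H.lower (n ^ 2) K n (hU' _ (by linarith) hnA.le) (by linarith) (by nlinarith)
    set m := (D (n ^ 2) K - D p K) / (n ^ 2 - p) with hm
    have hm0 : 0 < m := div_pos (by linarith) (by linarith)
    have haff : ∀ x, 0 < x → x ≤ 1 → 0 < D x K → D x K = D p K + m * (x - p) := by
      intro x hx hx1 hdx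
      rcases le_total p x with hle | hle
      · exact I.affine hp (by linarith) hnA hdp ⟨hle, by linarith⟩
      · have h1 := I.affine hx (by linarith) hnA hdx (x := p) ⟨hle, by linarith⟩
        set m' := (D (n ^ 2) K - D x K) / (n ^ 2 - x) with hm'
        have h2 : D (n ^ 2) K - D x K = m' * (n ^ 2 - x) := by
          rw [hm', div_mul_cancel₀ _ (by linarith)]
        have h3 : m = m' := by
          rw [hm, div_eq_iff (by linarith)]
          linear_combination h2 - h1
        rw [h3]; linear_combination -h1
    refine ⟨m, D p K - m * p, hm0, fun x hx hx1 => ?_⟩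
    rcases (H.nonneg x K (hU' x hx.le (by linarith))).eq_or_lt with h0 | h0
    · rw [← h0, eq_comm, max_eq_left_iff]
      have hxp : x < p := by
        by_contra hcon
        push Not at hcon
        rcases hcon.eq_or_lt with rfl | hlt
        · linarith
        · have := I.mono_left p x hp hlt (by linarith)
          linarith
      -- Every small `v > 0` is a value of `D · K` at some `y` in `[x, p]`, where the affine formula
      -- holds; hence the affine function at `x` is at most `v`.
      refine le_of_forall_gt_imp_ge_of_dense fun v hv => ?_
      rcases le_total (D p K) v with hpv | hpv
      · nlinarith
      · obtain ⟨y, ⟨hy1, hy2⟩, hy⟩ := intermediate_value_Icc hxp.le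
          (I.continuousOn hx (by linarith)) (show v ∈ Set.Icc (D x K) (D p K) from
            ⟨by linarith, hpv⟩)
        simp only at hy
        have := haff y (by linarith) (by linarith) (by linarith)
        nlinarith
    · rw [haff x hx hx1 h0, max_eq_right] <;> nlinarith [haff x hx hx1 h0]
  · push Not at hex
    -- Here `D` vanishes on `(0, 1]`, and any line that is nonpositive there will do.
    refine ⟨1, -1, one_pos, fun x hx hx1 => ?_⟩
    rw [max_eq_left (by linarith)]
    exact le_antisymm (hex x hx hx1) (H.nonneg x K (hU' x hx.le (by linarith)))

/-- Interior points are covered by `eq_of_interior`. At `x = 0` monotonicity of `D` gives only the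
upper bound; the lower bound uses `E` once more. -/
theorem exists_affine (H : CriticalValues n c A K D E) (hc : 1 ≤ c) (hcn : c < n)
    (hA : A = n ^ 2 + 1) (hK : K = (n + 2) * A) :
    ∃ lam gam : ℝ, 0 < lam ∧ ∀ x, 0 ≤ x → x ≤ 1 → D x n = max 0 (lam * x + gam) := by
  obtain ⟨m, g, hm, h⟩ := H.exists_affine_interior hc hcn hA hK
  have hA1 : 1 < A := by nlinarith
  have hK1 : n + 1 < K := by rw [hK]; nlinarith
  have hU : ∀ x b, 0 ≤ x → x ≤ 1 → c < b → b ≤ K → TwinForced c A K x b := by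
    intro x b h1 h2 h3 h4
    exact ⟨h1, by linarith, h4, h3, by nlinarith⟩
  have hint : ∀ x b, 0 < x → x ≤ 1 → c < b → b ≤ K → D x b = max 0 (m * x + g) := by
    intro x b h1 h2 h3 h4
    rw [H.eq_of_interior hc hcn hA1.le hK h1 (by linarith) (hU x b h1.le h2 h3 h4), h x h1 h2]
  refine ⟨m, g, hm, fun x hx hx1 => ?_⟩
  rcases hx.eq_or_lt with rfl | hx
  swap
  · exact hint x n hx hx1 hcn (by linarith)
  have u0 := hU 0 n le_rfl zero_le_one hcn (by linarith)
  have hupper : D 0 n ≤ max 0 g := by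
    refine le_of_forall_pos_le_add fun η hη => ?_
    obtain ⟨y, hy, hy'⟩ : ∃ y > 0, y < min 1 (η / m) :=
      exists_between (lt_min one_pos (div_pos hη hm))
    rw [lt_min_iff, lt_div_iff₀ hm] at hy'
    have h1 := H.mono_fst _ _ _ _ u0 (hU y n hy.le hy'.1.le hcn (by linarith)) hy
    rw [hint y n hy hy'.1.le hcn (by linarith)] at h1
    refine h1.trans (max_le ?_ ?_)
    · linarith [le_max_left 0 g]
    · linarith [le_max_right 0 g]
  rw [mul_zero, zero_add]
  rcases le_or_gt g 0 with hg | hg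
  · rw [max_eq_left hg] at hupper ⊢
    exact le_antisymm hupper (H.nonneg _ _ u0)
  · refine le_antisymm hupper ?_
    rw [max_eq_right hg.le]
    have hval : ∀ x b, 0 < x → x ≤ 1 → c < b → b ≤ K → D x b = m * x + g := by
      intro x b h1 h2 h3 h4
      rw [hint x b h1 h2 h3 h4, max_eq_right (by positivity)]
    refine le_of_forall_pos_le_add fun η hη => ?_
    obtain ⟨z, hz, hz'⟩ : ∃ z > 0, z < min 1 (η / m) :=
      exists_between (lt_min one_pos (div_pos hη hm))
    rw [lt_min_iff, lt_div_iff₀ hm] at hz'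
    obtain ⟨r, hr, hr'⟩ : ∃ r > 0, r < min (z / 6) ((n - c) / 3) :=
      exists_between (lt_min (by linarith) (by linarith))
    rw [lt_min_iff] at hr'
    obtain ⟨hr1, hr2⟩ := hr'
    have u1 := hU (r / 2) (n - r) (by linarith) (by linarith) (by linarith) (by linarith)
    have u2 := hU r (n + r) (by linarith) (by linarith) (by linarith) (by linarith)
    have u3 := hU z (n - 2 * r) (by linarith) (by linarith) (by linarith) (by linarith)
    have v1 := hval (r / 2) (n - r) (by linarith) (by linarith) (by linarith) (by linarith)
    have v2 := hval r (n + r) (by linarith) (by linarith) (by linarith) (by linarith)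
    have v3 := hval z (n - 2 * r) (by linarith) (by linarith) (by linarith) (by linarith)
    -- Altogether `D 0 n ≥ D (r / 2) (n - r) + D r (n + r) - D z (n - 2 * r)`, the values of `E`
    -- cancelling through `m3` and `m4`. The right side is at least `g - m * z`.
    have m1 := H.mono_add _ _ _ _ u1 u0 (by rw [v1]; positivity) (by linarith)
    have m2 := H.mono_add _ _ _ _ u2 u3 (by rw [v2]; positivity) (by linarith)
    have m3 := H.mono_snd _ _ _ _ u0 u2 (by linarith)
    have m4 := H.mono_snd _ _ _ _ u3 u1 (by linarith)
    have : 0 < m * r := by positivity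
    linarith

end CriticalValues

/-! ### Truthful mechanisms on a single pair -/

/-- The cost function on a pair of tasks; a set of tasks is given by its indicator. -/
def pairCost (t₁ t₂ t₁₂ : ℝ) : Bool × Bool → ℝ
  | (false, false) => 0
  | (true, false) => t₁
  | (false, true) => t₂
  | (true, true) => t₁₂

@[simp] theorem pairCost_none (t₁ t₂ t₁₂ : ℝ) : pairCost t₁ t₂ t₁₂ (false, false) = 0 := rfl
@[simp] theorem pairCost_fst (t₁ t₂ t₁₂ : ℝ) : pairCost t₁ t₂ t₁₂ (true, false) = t₁ := rfl
@[simp] theorem pairCost_snd (t₁ t₂ t₁₂ : ℝ) : pairCost t₁ t₂ t₁₂ (false, true) = t₂ := rfl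
@[simp] theorem pairCost_both (t₁ t₂ t₁₂ : ℝ) : pairCost t₁ t₂ t₁₂ (true, true) = t₁₂ := rfl

/-- Normalized, monotone and submodular cost functions on a pair of tasks. -/
structure IsPairCost (w : Bool × Bool → ℝ) : Prop where
  none : w (false, false) = 0
  fst_nonneg : 0 ≤ w (true, false)
  snd_nonneg : 0 ≤ w (false, true)
  fst_le : w (true, false) ≤ w (true, true)
  snd_le : w (false, true) ≤ w (true, true)
  both_le : w (true, true) ≤ w (true, false) + w (false, true)

theorem isPairCost_pairCost {t₁ t₂ t₁₂ : ℝ} (h₁ : 0 ≤ t₁) (h₂ : 0 ≤ t₂) (h₃ : t₁ ≤ t₁₂)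
    (h₄ : t₂ ≤ t₁₂) (h₅ : t₁₂ ≤ t₁ + t₂) : IsPairCost (pairCost t₁ t₂ t₁₂) :=
  ⟨rfl, h₁, h₂, h₃, h₄, h₅⟩

/-- The additive cost, for the other player, of the tasks that the `t`-player does not receive. -/
def leafCost (x b : ℝ) (p : Bool × Bool) : ℝ :=
  (if p.1 then 0 else x) + (if p.2 then 0 else b)

/-- A truthful and approximate mechanism for a `t`-player and one additive player on a pair of
tasks. `f` is the set of tasks of the `t`-player, `q₀` and `q₁` are the payments. -/
structure PairMechanism (c B : ℝ) (f : (Bool × Bool → ℝ) → ℝ → ℝ → Bool × Bool)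
    (q₀ q₁ : (Bool × Bool → ℝ) → ℝ → ℝ → ℝ) : Prop where
  truthful_root : ∀ w w' x b, IsPairCost w → IsPairCost w' → 0 ≤ x → 0 ≤ b → x + b ≤ B →
    q₀ w' x b - w (f w' x b) ≤ q₀ w x b - w (f w x b)
  truthful_leaf : ∀ w x b x' b', IsPairCost w → 0 ≤ x → 0 ≤ b → x + b ≤ B →
    0 ≤ x' → 0 ≤ b' → x' + b' ≤ B →
    q₁ w x' b' - leafCost x b (f w x' b') ≤ q₁ w x b - leafCost x b (f w x b)
  approx : ∀ w x b z p, IsPairCost w → 0 ≤ x → 0 ≤ b → x + b ≤ B → 1 ≤ z →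
    w p ≤ z → leafCost x b p ≤ z →
    w (f w x b) ≤ c * z ∧ leafCost x b (f w x b) ≤ c * z

/-- The negative of the utility of the `t`-player under truthful reporting. -/
def indirectCost (f : (Bool × Bool → ℝ) → ℝ → ℝ → Bool × Bool)
    (q₀ : (Bool × Bool → ℝ) → ℝ → ℝ → ℝ) (w : Bool × Bool → ℝ) (x b : ℝ) : ℝ :=
  w (f w x b) - q₀ w x b

theorem TwinForced.bounds {c A K x b : ℝ} (hU : TwinForced c A K x b) (hc : 1 ≤ c) :
    0 ≤ x ∧ 0 ≤ b ∧ x + b ≤ K + A :=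
  ⟨hU.1, by linarith [hU.2.2.2.1], by linarith [hU.2.1, hU.2.2.1]⟩

namespace PairMechanism

variable {c A K : ℝ} {f : (Bool × Bool → ℝ) → ℝ → ℝ → Bool × Bool}
  {q₀ q₁ : (Bool × Bool → ℝ) → ℝ → ℝ → ℝ}

theorem indirectCost_le (H : PairMechanism c (K + A) f q₀ q₁) (hc : 1 ≤ c) {x b : ℝ}
    (hU : TwinForced c A K x b) {w w' : Bool × Bool → ℝ} (hw : IsPairCost w)
    (hw' : IsPairCost w') {p : Bool × Bool} (hp : f w' x b = p) :
    indirectCost f q₀ w x b ≤ indirectCost f q₀ w' x b + w p - w' p := by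
  obtain ⟨h1, h2, h3⟩ := hU.bounds hc
  have := H.truthful_root w w' x b hw hw' h1 h2 h3
  subst hp
  unfold indirectCost
  linarith

theorem leafCost_add_le (H : PairMechanism c (K + A) f q₀ q₁) (hc : 1 ≤ c) {x b x' b' : ℝ}
    (hU : TwinForced c A K x b) (hU' : TwinForced c A K x' b') {w : Bool × Bool → ℝ}
    (hw : IsPairCost w) {p p' : Bool × Bool} (hp : f w x b = p) (hp' : f w x' b' = p') :
    leafCost x b p + leafCost x' b' p' ≤ leafCost x b p' + leafCost x' b' p := by
  obtain ⟨h1, h2, h3⟩ := hU.bounds hc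
  obtain ⟨h1', h2', h3'⟩ := hU'.bounds hc
  have e1 := H.truthful_leaf w x b x' b' hw h1 h2 h3 h1' h2' h3'
  have e2 := H.truthful_leaf w x' b' x b hw h1' h2' h3' h1 h2 h3
  rw [hp, hp'] at e1 e2
  linarith

/-- Giving only the twin to the root has makespan at most `max 1 x`, whereas a leaf that keeps the
twin pays at least `b`, more than `c` times this. -/
theorem snd_eq_true (H : PairMechanism c (K + A) f q₀ q₁) (hc : 1 ≤ c) {x b : ℝ}
    (hU : TwinForced c A K x b) {w : Bool × Bool → ℝ} (hw : IsPairCost w)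
    (h : w (false, true) ≤ 1) : (f w x b).2 = true := by
  obtain ⟨h1, h2, h3⟩ := hU.bounds hc
  obtain ⟨-, -, -, h4, h5⟩ := hU
  have := (H.approx w x b (max 1 x) (false, true) hw h1 h2 h3 (le_max_left _ _)
    (h.trans (le_max_left _ _)) (by simp [leafCost])).2
  by_contra hcon
  rw [mul_max_of_nonneg _ _ (by linarith), mul_one, le_max_iff] at this
  simp only [leafCost, hcon] at this
  have : 0 ≤ if (f w x b).1 = true then 0 else x := by split_ifs <;> simp [h1]
  rcases ‹_ ∨ _› with h' | h' <;> simp at h' <;> linarith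

theorem eq_or_eq (H : PairMechanism c (K + A) f q₀ q₁) (hc : 1 ≤ c) {x b : ℝ}
    (hU : TwinForced c A K x b) {w : Bool × Bool → ℝ} (hw : IsPairCost w)
    (h : w (false, true) ≤ 1) : f w x b = (false, true) ∨ f w x b = (true, true) := by
  have := H.snd_eq_true hc hU hw h
  rcases hf : f w x b with ⟨_ | _, _ | _⟩ <;> simp_all

/-- The leaf can take both tasks at cost at most `K + A`. Hence the root never receives a bundle of
cost `L` once `L > c * (K + A)`. -/
theorem cost_le (H : PairMechanism c (K + A) f q₀ q₁) (hc : 1 ≤ c) (hK : 1 ≤ K + A) {x b : ℝ}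
    (hU : TwinForced c A K x b) {w : Bool × Bool → ℝ} (hw : IsPairCost w)
    {p : Bool × Bool} (hp : f w x b = p) : w p ≤ c * (K + A) := by
  obtain ⟨h1, h2, h3⟩ := hU.bounds hc
  subst hp
  exact (H.approx w x b (K + A) (false, false) hw h1 h2 h3 hK (by rw [hw.none]; linarith)
    (by simpa [leafCost] using h3)).1

/-- The critical value of the additional cost of the first task, given that the `t`-player
receives the second one. -/
def firstValue (f : (Bool × Bool → ℝ) → ℝ → ℝ → Bool × Bool)
    (q₀ : (Bool × Bool → ℝ) → ℝ → ℝ → ℝ) (L x b : ℝ) : ℝ :=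
  indirectCost f q₀ (pairCost L 0 L) x b - indirectCost f q₀ (pairCost 0 0 0) x b

/-- The critical value of the cost of the second task, given that the `t`-player does not
receive the first one. -/
def secondValue (f : (Bool × Bool → ℝ) → ℝ → ℝ → Bool × Bool)
    (q₀ : (Bool × Bool → ℝ) → ℝ → ℝ → ℝ) (L x b : ℝ) : ℝ :=
  indirectCost f q₀ (pairCost L L L) x b - indirectCost f q₀ (pairCost L 0 L) x b

section

variable {L x b : ℝ}

theorem isPairCost_zero : IsPairCost (pairCost 0 0 0) := by
  apply isPairCost_pairCost <;> simp

theorem isPairCost_first {y : ℝ} (hy : 0 ≤ y) : IsPairCost (pairCost y 0 y) := by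
  apply isPairCost_pairCost <;> linarith

theorem isPairCost_const {y : ℝ} (hy : 0 ≤ y) : IsPairCost (pairCost y y y) := by
  apply isPairCost_pairCost <;> linarith

theorem isPairCost_large {e : ℝ} (he : 0 ≤ e) (heL : e ≤ L) : IsPairCost (pairCost L e L) := by
  apply isPairCost_pairCost <;> linarith

theorem large_pos (hc : 1 ≤ c) (hK : 1 ≤ K + A) (hL : c * (K + A) < L) : 0 < L := by nlinarith

theorem alloc_large_zero (H : PairMechanism c (K + A) f q₀ q₁) (hc : 1 ≤ c) (hK : 1 ≤ K + A)
    (hL : c * (K + A) < L) (hU : TwinForced c A K x b) : f (pairCost L 0 L) x b = (false, true) := by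
  have hL0 := large_pos hc hK hL
  have hw := isPairCost_first hL0.le
  refine (H.eq_or_eq hc hU hw (by simp)).resolve_right fun h => ?_
  have := H.cost_le hc hK hU hw h
  simp at this
  linarith

theorem alloc_large (H : PairMechanism c (K + A) f q₀ q₁) (hc : 1 ≤ c) (hK : 1 ≤ K + A)
    (hL : c * (K + A) < L) (hU : TwinForced c A K x b) : f (pairCost L L L) x b = (false, false) := by
  have hw := isPairCost_const (large_pos hc hK hL).le
  rcases hf : f (pairCost L L L) x b with ⟨_ | _, _ | _⟩
  · rfl
  all_goals
    have := H.cost_le hc hK hU hw hf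
    simp at this
    linarith

theorem firstValue_nonneg (H : PairMechanism c (K + A) f q₀ q₁) (hc : 1 ≤ c) (hK : 1 ≤ K + A)
    (hL : c * (K + A) < L) (hU : TwinForced c A K x b) : 0 ≤ firstValue f q₀ L x b := by
  have := H.indirectCost_le hc hU isPairCost_zero
    (isPairCost_first (large_pos hc hK hL).le) (H.alloc_large_zero hc hK hL hU)
  simp at this
  unfold firstValue
  linarith

theorem secondValue_nonneg (H : PairMechanism c (K + A) f q₀ q₁) (hc : 1 ≤ c) (hK : 1 ≤ K + A)
    (hL : c * (K + A) < L) (hU : TwinForced c A K x b) : 0 ≤ secondValue f q₀ L x b := by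
  have hL0 := large_pos hc hK hL
  have := H.indirectCost_le hc hU (isPairCost_first hL0.le)
    (isPairCost_const hL0.le) (H.alloc_large hc hK hL hU)
  simp at this
  unfold secondValue
  linarith

theorem secondValue_le (H : PairMechanism c (K + A) f q₀ q₁) (hc : 1 ≤ c) (hK : 1 ≤ K + A)
    (hL : c * (K + A) < L) (hU : TwinForced c A K x b) : secondValue f q₀ L x b ≤ L := by
  have hL0 := large_pos hc hK hL
  have := H.indirectCost_le hc hU (isPairCost_const hL0.le)
    (isPairCost_first hL0.le) (H.alloc_large_zero hc hK hL hU)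
  simp at this
  unfold secondValue
  linarith

theorem alloc_zero (H : PairMechanism c (K + A) f q₀ q₁) (hc : 1 ≤ c) (hK : 1 ≤ K + A)
    (hL : c * (K + A) < L) (hU : TwinForced c A K x b)
    (h : 0 < firstValue f q₀ L x b) :
    f (pairCost 0 0 0) x b = (true, true) := by
  refine (H.eq_or_eq hc hU isPairCost_zero (by simp)).resolve_left fun hf => ?_
  have := H.indirectCost_le hc hU (isPairCost_first (large_pos hc hK hL).le) isPairCost_zero hf
  simp at this
  unfold firstValue at h
  linarith

theorem alloc_first_of_lt (H : PairMechanism c (K + A) f q₀ q₁) (hc : 1 ≤ c) (hK : 1 ≤ K + A)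
    (hL : c * (K + A) < L) (hU : TwinForced c A K x b)
    {y : ℝ} (hy : 0 ≤ y) (h : y < firstValue f q₀ L x b) :
    f (pairCost y 0 y) x b = (true, true) := by
  have hw := isPairCost_first hy
  refine (H.eq_or_eq hc hU hw (by simp)).resolve_left fun hf => ?_
  have h0 := H.alloc_zero hc hK hL hU (hy.trans_lt h)
  have e1 := H.indirectCost_le hc hU (isPairCost_first (large_pos hc hK hL).le) hw hf
  have e2 := H.indirectCost_le hc hU hw isPairCost_zero h0
  simp at e1 e2
  unfold firstValue at h
  linarith

theorem alloc_first_of_gt (H : PairMechanism c (K + A) f q₀ q₁) (hc : 1 ≤ c) (hK : 1 ≤ K + A)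
    (hL : c * (K + A) < L) (hU : TwinForced c A K x b)
    {y : ℝ} (h : firstValue f q₀ L x b < y) :
    f (pairCost y 0 y) x b = (false, true) := by
  have hy := (H.firstValue_nonneg hc hK hL hU).trans h.le
  have hw := isPairCost_first hy
  refine (H.eq_or_eq hc hU hw (by simp)).resolve_right fun hf => ?_
  have e1 := H.indirectCost_le hc hU isPairCost_zero hw hf
  have e2 := H.indirectCost_le hc hU hw (isPairCost_first (large_pos hc hK hL).le)
    (H.alloc_large_zero hc hK hL hU)
  simp at e1 e2
  unfold firstValue at h
  linarith

theorem alloc_second_of_lt (H : PairMechanism c (K + A) f q₀ q₁) (hc : 1 ≤ c) (hK : 1 ≤ K + A)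
    (hL : c * (K + A) < L) (hU : TwinForced c A K x b)
    {e : ℝ} (he : 0 ≤ e) (heL : e ≤ L)
    (h : e < secondValue f q₀ L x b) : f (pairCost L e L) x b = (false, true) := by
  have hw := isPairCost_large he heL
  have hL0 := large_pos hc hK hL
  rcases hf : f (pairCost L e L) x b with ⟨_ | _, _ | _⟩
  · have e1 := H.indirectCost_le hc hU (isPairCost_const hL0.le) hw hf
    have e2 := H.indirectCost_le hc hU hw (isPairCost_first hL0.le)
      (H.alloc_large_zero hc hK hL hU)
    simp at e1 e2
    unfold secondValue at h
    linarith
  · rfl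
  all_goals
    have := H.cost_le hc hK hU hw hf
    simp at this
    linarith

theorem alloc_second_of_gt (H : PairMechanism c (K + A) f q₀ q₁) (hc : 1 ≤ c) (hK : 1 ≤ K + A)
    (hL : c * (K + A) < L) (hU : TwinForced c A K x b)
    {e : ℝ} (heL : e ≤ L)
    (h : secondValue f q₀ L x b < e) : f (pairCost L e L) x b = (false, false) := by
  have he := (H.secondValue_nonneg hc hK hL hU).trans h.le
  have hw := isPairCost_large he heL
  have hL0 := large_pos hc hK hL
  rcases hf : f (pairCost L e L) x b with ⟨_ | _, _ | _⟩
  · rfl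
  · have e1 := H.indirectCost_le hc hU (isPairCost_first hL0.le) hw hf
    have e2 := H.indirectCost_le hc hU hw (isPairCost_const hL0.le)
      (H.alloc_large hc hK hL hU)
    simp at e1 e2
    unfold secondValue at h
    linarith
  all_goals
    have := H.cost_le hc hK hU hw hf
    simp at this
    linarith

theorem alloc_const_of_gt (H : PairMechanism c (K + A) f q₀ q₁) (hc : 1 ≤ c) (hK : 1 ≤ K + A)
    (hL : c * (K + A) < L) (hU : TwinForced c A K x b)
    {y : ℝ}
    (h : firstValue f q₀ L x b + secondValue f q₀ L x b < y) :
    f (pairCost y y y) x b = (false, false) := by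
  have h1 := H.firstValue_nonneg hc hK hL hU
  have h2 := H.secondValue_nonneg hc hK hL hU
  have hw := isPairCost_const (y := y) (by linarith)
  have e2 := H.indirectCost_le hc hU hw (isPairCost_const (large_pos hc hK hL).le)
      (H.alloc_large hc hK hL hU)
  unfold firstValue secondValue at h
  rcases hf : f (pairCost y y y) x b with ⟨_ | _, _ | _⟩
  · rfl
  all_goals
    have e1 := H.indirectCost_le hc hU isPairCost_zero hw hf
    simp at e1 e2
    linarith

/-- Comparing indirect costs excludes the empty bundle and the twin alone. The first task alone
costs as much as both and needs the auxiliary cost below. -/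
theorem alloc_const_of_lt (H : PairMechanism c (K + A) f q₀ q₁) (hc : 1 ≤ c) (hK : 1 ≤ K + A)
    (hL : c * (K + A) < L) (hU : TwinForced c A K x b)
    {y : ℝ} (hy : 0 ≤ y) (hD : 0 < firstValue f q₀ L x b)
    (h : y < firstValue f q₀ L x b + secondValue f q₀ L x b) :
    f (pairCost y y y) x b = (true, true) := by
  have hw := isPairCost_const hy
  have hL0 := large_pos hc hK hL
  have h0 := H.alloc_zero hc hK hL hU hD
  have e2 := H.indirectCost_le hc hU hw isPairCost_zero h0
  simp at e2
  rcases hf : f (pairCost y y y) x b with ⟨_ | _, _ | _⟩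
  · have e1 := H.indirectCost_le hc hU (isPairCost_const hL0.le) hw hf
    simp at e1
    unfold firstValue secondValue at h
    linarith
  · have e1 := H.indirectCost_le hc hU (isPairCost_first hL0.le) hw hf
    simp at e1
    unfold firstValue at hD
    linarith
  -- At the additive cost `(δ, δ, 2δ)` the root must receive both tasks, as `δ` is below both `1`
  -- and the critical value. Truthfulness between this cost and `(y, y, y)` then yields `δ ≤ 0`.
  · obtain ⟨δ, hδ, hδ'⟩ : ∃ δ > 0, δ < min 1 (firstValue f q₀ L x b) :=
      exists_between (lt_min one_pos hD)
    rw [lt_min_iff] at hδ'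
    have hv : IsPairCost (pairCost δ δ (δ + δ)) := by apply isPairCost_pairCost <;> linarith
    rcases H.eq_or_eq hc hU hv (by simpa using hδ'.1.le) with hg | hg
    · have e3 := H.indirectCost_le hc hU (isPairCost_first hL0.le) hv hg
      have e4 := H.indirectCost_le hc hU hv isPairCost_zero h0
      simp at e3 e4
      unfold firstValue at hδ'
      linarith
    · have e3 := H.indirectCost_le hc hU hw hv hg
      have e4 := H.indirectCost_le hc hU hv hw hf
      simp at e3 e4
      linarith
  · rfl

end

/-- If a monotonicity failed, a root cost strictly between the two critical values would be
allocated differently at the two leaf inputs, against two-cycle monotonicity of the leaf. The last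
two bounds use the approximation ratio. -/
theorem criticalValues (H : PairMechanism c (K + A) f q₀ q₁) (hc : 1 ≤ c) (hK : 1 ≤ K + A)
    {L : ℝ} (hL : c * (K + A) < L) (n : ℝ) :
    CriticalValues n c A K (firstValue f q₀ L) (secondValue f q₀ L) where
  nonneg x b hU := H.firstValue_nonneg hc hK hL hU
  mono_fst x b y b' hU hU' hlt := by
    by_contra! hcon
    obtain ⟨d, hd1, hd2⟩ := exists_between hcon
    have hd0 := (H.firstValue_nonneg hc hK hL hU').trans hd1.le
    have := H.leafCost_add_le hc hU hU' (isPairCost_first hd0)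
      (H.alloc_first_of_lt hc hK hL hU hd0 hd2) (H.alloc_first_of_gt hc hK hL hU' hd1)
    simp [leafCost] at this
    linarith
  mono_snd x b y b' hU hU' hlt := by
    by_contra! hcon
    obtain ⟨d, hd1, hd2⟩ := exists_between hcon
    have hd0 := (H.secondValue_nonneg hc hK hL hU').trans hd1.le
    have hdL := hd2.le.trans (H.secondValue_le hc hK hL hU)
    have := H.leafCost_add_le hc hU hU' (isPairCost_large hd0 hdL)
      (H.alloc_second_of_lt hc hK hL hU hd0 hdL hd2) (H.alloc_second_of_gt hc hK hL hU' hdL hd1)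
    simp [leafCost] at this
    linarith
  mono_add x b y b' hU hU' hpos hlt := by
    by_contra! hcon
    obtain ⟨d, hd1, hd2⟩ := exists_between hcon
    have hd0 : 0 ≤ d := (add_nonneg (H.firstValue_nonneg hc hK hL hU')
      (H.secondValue_nonneg hc hK hL hU')).trans hd1.le
    have := H.leafCost_add_le hc hU hU' (isPairCost_const hd0)
      (H.alloc_const_of_lt hc hK hL hU hd0 hpos hd2) (H.alloc_const_of_gt hc hK hL hU' hd1)
    simp [leafCost] at this
    linarith
  lower x b z hU hz hlt := by
    by_contra! hcon
    obtain ⟨d, hd1, hd2⟩ := exists_between hcon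
    have hd0 := (H.firstValue_nonneg hc hK hL hU).trans hd1.le
    obtain ⟨h1, h2, h3⟩ := hU.bounds hc
    have hf := H.alloc_first_of_gt hc hK hL hU hd1
    have := (H.approx _ x b z (true, true) (isPairCost_first hd0) h1 h2 h3 hz
      (by simpa using hd2.le) (by simp [leafCost]; linarith)).2
    rw [hf] at this
    simp [leafCost] at this
    linarith
  upper x b hU hx := by
    by_contra! hcon
    obtain ⟨d, hd1, hd2⟩ := exists_between hcon
    have hd0 : 0 ≤ d := by linarith
    obtain ⟨h1, h2, h3⟩ := hU.bounds hc
    have hf := H.alloc_first_of_lt hc hK hL hU hd0 hd2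
    have := (H.approx _ x b 1 (false, true) (isPairCost_first hd0) h1 h2 h3 le_rfl
      (by simp) (by simpa [leafCost] using hx)).1
    rw [hf] at this
    simp at this
    linarith

/-- The critical values of the first task are linear, truncated at zero. -/
theorem exists_linear {n : ℝ} (H : PairMechanism c (K + A) f q₀ q₁) (hc : 1 ≤ c) (hcn : c < n)
    (hA : A = n ^ 2 + 1) (hK : K = (n + 2) * A) :
    ∃ lam gam : ℝ, 0 < lam ∧ ∀ x y, 0 ≤ x → 0 ≤ y → y ≤ 1 →
      (x < max 0 (lam * y + gam) → (f (pairCost x 0 x) y n).1 = true) ∧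
      (max 0 (lam * y + gam) < x → (f (pairCost x 0 x) y n).1 = false) := by
  have hA1 : 1 ≤ A := by nlinarith
  have hK1 : n ≤ K := by rw [hK]; nlinarith
  have hKA : 1 ≤ K + A := by linarith
  have hL : c * (K + A) < c * (K + A) + 1 := lt_add_one _
  obtain ⟨lam, gam, hl, h⟩ := (H.criticalValues hc hKA hL n).exists_affine hc hcn hA hK
  refine ⟨lam, gam, hl, fun x y hx hy hy1 => ?_⟩
  rw [← h y hy hy1]
  have hU : TwinForced c A K y n := ⟨hy, by linarith, hK1, hcn, by nlinarith⟩
  exact ⟨fun hlt => by rw [H.alloc_first_of_lt hc hKA hL hU hx hlt],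
    fun hlt => by rw [H.alloc_first_of_gt hc hKA hL hU hlt]⟩

end PairMechanism

/-! ### Profiles with twin tasks and their makespans -/

section TwinProfiles

variable {n : ℕ}

/-- The indicator of `S` on the `j`-th pair of twin tasks. -/
def pairIndicator (S : Finset (TwinTask n)) (j : Fin (n - 1)) : Bool × Bool :=
  (decide ((j, false) ∈ S), decide ((j, true) ∈ S))

/-- The cost function that is additive across pairs, with cost `W j` on the `j`-th pair. -/
def rootCost (W : Fin (n - 1) → Bool × Bool → ℝ) : CostFun (TwinTask n) :=
  fun S => ∑ j, W j (pairIndicator S j)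

/-- The additive cost function of the player associated with the `j`-th pair. -/
def twinLeaf (Θ : ℝ) (j : Fin (n - 1)) (x b : ℝ) : CostFun (TwinTask n) :=
  fun S => ∑ y ∈ S, if y.1 = j then (if y.2 then b else x) else Θ

def twinProfile (Θ : ℝ) (W : Fin (n - 1) → Bool × Bool → ℝ) (x b : Fin (n - 1) → ℝ) :
    Profile (TwinPlayer n) (TwinTask n)
  | none => rootCost W
  | some j => twinLeaf Θ j (x j) (b j)

theorem IsPairCost.nonneg {w : Bool × Bool → ℝ} (hw : IsPairCost w) (p : Bool × Bool) :
    0 ≤ w p := by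
  obtain ⟨h0, h1, h2, h3, h4, h5⟩ := hw
  rcases p with ⟨_ | _, _ | _⟩ <;> linarith

theorem IsPairCost.mono {w : Bool × Bool → ℝ} (hw : IsPairCost w) {p q : Bool × Bool}
    (h₁ : p.1 = true → q.1 = true) (h₂ : p.2 = true → q.2 = true) : w p ≤ w q := by
  obtain ⟨h0, h1, h2, h3, h4, h5⟩ := hw
  rcases p with ⟨_ | _, _ | _⟩ <;> rcases q with ⟨_ | _, _ | _⟩ <;>
    (simp_all; try linarith)

theorem pairIndicator_empty (j : Fin (n - 1)) :
    pairIndicator (∅ : Finset (TwinTask n)) j = (false, false) := by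
  simp [pairIndicator]

theorem pairIndicator_inter_self (S : Finset (TwinTask n)) (j : Fin (n - 1)) :
    pairIndicator (S ∩ twinPair j) j = pairIndicator S j := by
  simp [pairIndicator, twinPair]

theorem pairIndicator_of_subset {S : Finset (TwinTask n)} {i j : Fin (n - 1)}
    (hS : S ⊆ twinPair i) (hj : j ≠ i) : pairIndicator S j = (false, false) := by
  have : ∀ k, (j, k) ∉ S := fun k hk => by
    have := hS hk
    simp [twinPair] at this
    tauto
  simp [pairIndicator, this]

theorem rootCost_of_subset {W : Fin (n - 1) → Bool × Bool → ℝ} (hW : ∀ j, IsPairCost (W j))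
    {S : Finset (TwinTask n)} {i : Fin (n - 1)} (hS : S ⊆ twinPair i) :
    rootCost W S = W i (pairIndicator S i) := by
  refine Finset.sum_eq_single i (fun j _ hj => ?_) (by simp)
  rw [pairIndicator_of_subset hS hj, (hW j).none]

theorem IsPairCost.submodular {w : Bool × Bool → ℝ} (hw : IsPairCost w)
    (S T : Finset (TwinTask n)) (i : Fin (n - 1)) :
    w (pairIndicator (S ∪ T) i) + w (pairIndicator (S ∩ T) i) ≤
      w (pairIndicator S i) + w (pairIndicator T i) := by
  obtain ⟨h0, h1, h2, h3, h4, h5⟩ := hw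
  by_cases a1 : (i, false) ∈ S <;> by_cases a2 : (i, true) ∈ S <;>
    by_cases a3 : (i, false) ∈ T <;> by_cases a4 : (i, true) ∈ T <;>
    simp [pairIndicator, a1, a2, a3, a4] <;> linarith

theorem rootCost_mem {W : Fin (n - 1) → Bool × Bool → ℝ} (hW : ∀ j, IsPairCost (W j)) (Θ : ℝ) :
    rootCost W ∈ twinDomain n Θ none := by
  refine ⟨?_, fun S T hST => ?_, fun i S T hS hT => ?_, fun S => ?_⟩
  · exact Finset.sum_eq_zero fun j _ => by rw [pairIndicator_empty, (hW j).none]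
  · exact Finset.sum_le_sum fun j _ => (hW j).mono
      (by simpa [pairIndicator] using fun h => hST h) (by simpa [pairIndicator] using fun h => hST h)
  · rw [rootCost_of_subset hW hS, rootCost_of_subset hW hT,
      rootCost_of_subset hW (Finset.union_subset hS hT),
      rootCost_of_subset hW (Finset.inter_subset_left.trans hS)]
    exact (hW i).submodular S T i
  · refine Finset.sum_congr rfl fun j _ => ?_
    rw [rootCost_of_subset hW Finset.inter_subset_right, pairIndicator_inter_self]

theorem twinLeaf_mem {Θ x b : ℝ} (hΘ : 0 ≤ Θ) (hx : 0 ≤ x) (hb : 0 ≤ b) (i : Fin (n - 1)) :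
    twinLeaf Θ i x b ∈ twinDomain n Θ (some i) := by
  refine ⟨⟨fun y => ?_, fun S => ?_⟩, fun j hj => ?_⟩
  · simp only [twinLeaf, Finset.sum_singleton]
    split_ifs <;> assumption
  · simp [twinLeaf]
  · simp [twinLeaf, hj]

theorem twinProfile_inDomain {Θ : ℝ} (hΘ : 0 ≤ Θ) {W : Fin (n - 1) → Bool × Bool → ℝ}
    (hW : ∀ j, IsPairCost (W j)) {x b : Fin (n - 1) → ℝ} (hx : ∀ j, 0 ≤ x j)
    (hb : ∀ j, 0 ≤ b j) : InDomain (twinDomain n Θ) (twinProfile Θ W x b) := by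
  rintro (_ | j)
  · exact rootCost_mem hW Θ
  · exact twinLeaf_mem hΘ (hx j) (hb j) j

theorem update_twinProfile_none (Θ : ℝ) (W W' : Fin (n - 1) → Bool × Bool → ℝ)
    (x b : Fin (n - 1) → ℝ) :
    Function.update (twinProfile Θ W x b) none (rootCost W') = twinProfile Θ W' x b := by
  funext k
  rcases k with _ | j
  · simp [twinProfile]
  · simp [twinProfile]

theorem update_twinProfile_some (Θ : ℝ) (W : Fin (n - 1) → Bool × Bool → ℝ)
    (x b : Fin (n - 1) → ℝ) (i : Fin (n - 1)) (u v u' v' : ℝ) :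
    Function.update (twinProfile Θ W (Function.update x i u) (Function.update b i v)) (some i)
      (twinLeaf Θ i u' v') =
      twinProfile Θ W (Function.update x i u') (Function.update b i v') := by
  funext k
  rcases k with _ | j
  · simp [twinProfile]
  · rcases eq_or_ne j i with rfl | hj
    · simp [twinProfile]
    · simp [twinProfile, hj]

theorem restrictedInstance_eq_twinProfile (Θ : ℝ) (t s : Fin (n - 1) → ℝ) :
    restrictedInstance n Θ t s =
      twinProfile Θ (fun j => pairCost (t j) 0 (t j)) s (fun _ => (n : ℝ)) := by
  funext k
  rcases k with _ | j
  · funext S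
    simp only [restrictedInstance, twinProfile, rootCost]
    rw [← Finset.univ_inter S, ← Finset.sum_ite_mem, Fintype.sum_prod_type, Finset.univ_inter]
    refine Finset.sum_congr rfl fun j _ => ?_
    by_cases h1 : (j, false) ∈ S <;> by_cases h2 : (j, true) ∈ S <;>
      simp [pairIndicator, h1, h2]
  · rfl

section Makespan

variable {ι τ : Type} [Fintype ι] [Nonempty ι] [DecidableEq ι] [Fintype τ]

theorem le_makespan (b : Profile ι τ) (a : Allocation ι τ) (i : ι) :
    b i (bundle a i) ≤ makespan b a :=
  Finset.le_sup' (fun i => b i (bundle a i)) (Finset.mem_univ i)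

theorem makespan_le {b : Profile ι τ} {a : Allocation ι τ} {z : ℝ}
    (h : ∀ i, b i (bundle a i) ≤ z) : makespan b a ≤ z :=
  Finset.sup'_le _ _ fun i _ => h i

theorem optMakespan_le [DecidableEq τ] (b : Profile ι τ) (a : Allocation ι τ) :
    optMakespan b ≤ makespan b a :=
  Finset.inf'_le _ (Finset.mem_univ a)

theorem optMakespan_nonneg [DecidableEq τ] {b : Profile ι τ} {i : ι} (h : ∀ S, 0 ≤ b i S) :
    0 ≤ optMakespan b :=
  Finset.le_inf' _ _ fun a _ => (h _).trans (le_makespan b a i)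

end Makespan

/-- The allocation that gives the tasks `P j` of the `j`-th pair to the `t`-player, and the others
to the player associated with this pair. -/
def splitAlloc (P : Fin (n - 1) → Bool × Bool) : Allocation (TwinPlayer n) (TwinTask n) :=
  fun y => if (if y.2 then (P y.1).2 else (P y.1).1) then none else some y.1

theorem pairIndicator_splitAlloc (P : Fin (n - 1) → Bool × Bool) (j : Fin (n - 1)) :
    pairIndicator (bundle (splitAlloc P) none) j = P j := by
  simp [pairIndicator, bundle, splitAlloc]

theorem twinLeaf_eq_leafCost {Θ x b : ℝ} {a : Allocation (TwinPlayer n) (TwinTask n)}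
    {i : Fin (n - 1)} (hout : ∀ j k, j ≠ i → a (j, k) ≠ some i)
    (hin : ∀ k, a (i, k) = none ∨ a (i, k) = some i) :
    twinLeaf Θ i x b (bundle a (some i)) = leafCost x b (pairIndicator (bundle a none) i) := by
  unfold twinLeaf bundle
  rw [Finset.sum_filter, Fintype.sum_prod_type, Finset.sum_eq_single i]
  · rcases hin false with h1 | h1 <;> rcases hin true with h2 | h2 <;>
      simp [h1, h2, leafCost, pairIndicator, add_comm]
  · intro j _ hj
    simp [hout j _ hj]
  · simp

theorem optMakespan_twinProfile_le {Θ : ℝ} {W : Fin (n - 1) → Bool × Bool → ℝ}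
    {x b : Fin (n - 1) → ℝ} {z : ℝ} (P : Fin (n - 1) → Bool × Bool)
    (hroot : ∑ j, W j (P j) ≤ z) (hleaf : ∀ j, leafCost (x j) (b j) (P j) ≤ z) :
    optMakespan (twinProfile Θ W x b) ≤ z := by
  refine (optMakespan_le _ (splitAlloc P)).trans (makespan_le ?_)
  rintro (_ | j)
  · simpa [twinProfile, rootCost, pairIndicator_splitAlloc] using hroot
  · simp only [twinProfile]
    rw [twinLeaf_eq_leafCost, pairIndicator_splitAlloc]
    · exact hleaf j
    · intro k l hk
      simp only [splitAlloc]
      split_ifs <;> simp [hk]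
    · intro k
      by_cases h : (if k then (P j).2 else (P j).1) = true <;> simp [splitAlloc, h]

theorem le_twinLeaf {Θ x b : ℝ} (hΘ : 0 ≤ Θ) (hx : 0 ≤ x) (hb : 0 ≤ b) {i : Fin (n - 1)}
    {S : Finset (TwinTask n)} {y : TwinTask n} (hy : y ∈ S) (hyi : y.1 ≠ i) :
    Θ ≤ twinLeaf Θ i x b S := by
  have := Finset.single_le_sum (s := S)
    (f := fun y : TwinTask n => if y.1 = i then (if y.2 then b else x) else Θ)
    (fun y _ => by split_ifs <;> assumption) hy
  rwa [if_neg hyi] at this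

/-- A leaf holding a task of another pair already pays `Θ`. -/
theorem eq_of_makespan_lt {Θ : ℝ} {W : Fin (n - 1) → Bool × Bool → ℝ}
    {x b : Fin (n - 1) → ℝ} (hΘ : 0 ≤ Θ) (hx : ∀ j, 0 ≤ x j) (hb : ∀ j, 0 ≤ b j)
    {a : Allocation (TwinPlayer n) (TwinTask n)} (h : makespan (twinProfile Θ W x b) a < Θ)
    {i j : Fin (n - 1)} {k : Bool} (ha : a (j, k) = some i) : j = i := by
  by_contra hne
  have h1 := le_twinLeaf hΘ (hx i) (hb i) (i := i) (S := bundle a (some i)) (y := (j, k))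
    (by simp [bundle, ha]) hne
  have h2 := le_makespan (twinProfile Θ W x b) a (some i)
  simp only [twinProfile] at h2
  linarith

theorem twinLeaf_eq_leafCost_of_makespan_lt {Θ : ℝ} {W : Fin (n - 1) → Bool × Bool → ℝ}
    {x b : Fin (n - 1) → ℝ} (hΘ : 0 ≤ Θ) (hx : ∀ j, 0 ≤ x j) (hb : ∀ j, 0 ≤ b j)
    {a : Allocation (TwinPlayer n) (TwinTask n)} (h : makespan (twinProfile Θ W x b) a < Θ)
    (i : Fin (n - 1)) (u v : ℝ) :
    twinLeaf Θ i u v (bundle a (some i)) = leafCost u v (pairIndicator (bundle a none) i) := by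
  refine twinLeaf_eq_leafCost (fun j k hj ha => hj (eq_of_makespan_lt hΘ hx hb h ha))
    fun k => ?_
  rcases ha : a (i, k) with _ | j
  · exact Or.inl rfl
  · rw [eq_of_makespan_lt hΘ hx hb h ha]
    exact Or.inr rfl

/-! ### Reduction to a single pair -/

/-- The profiles in which only the costs of the `i`-th pair vary. -/
def pairProfile (Θ : ℝ) (t s : Fin (n - 1) → ℝ) (i : Fin (n - 1)) (w : Bool × Bool → ℝ)
    (x b : ℝ) : Profile (TwinPlayer n) (TwinTask n) :=
  twinProfile Θ (Function.update (fun j => pairCost (t j) 0 (t j)) i w)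
    (Function.update s i x) (Function.update (fun _ => (n : ℝ)) i b)

theorem restrictedInstance_eq_pairProfile (Θ : ℝ) (t s t' s' : Fin (n - 1) → ℝ)
    (i : Fin (n - 1)) (ht : dropCoord i t' = dropCoord i t) (hs : dropCoord i s' = dropCoord i s) :
    restrictedInstance n Θ t' s' =
      pairProfile Θ t s i (pairCost (t' i) 0 (t' i)) (s' i) n := by
  have ht' : ∀ j, j ≠ i → t' j = t j := fun j hj => congrFun ht ⟨j, hj⟩
  have hs' : ∀ j, j ≠ i → s' j = s j := fun j hj => congrFun hs ⟨j, hj⟩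
  rw [restrictedInstance_eq_twinProfile, pairProfile]
  congr 1 <;> funext j <;> rcases eq_or_ne j i with rfl | hj <;> simp [*]

/-- The tasks of the `i`-th pair that the `t`-player receives. -/
def pairAlloc (M : Mechanism (TwinPlayer n) (TwinTask n)) (Θ : ℝ) (t s : Fin (n - 1) → ℝ)
    (i : Fin (n - 1)) (w : Bool × Bool → ℝ) (x b : ℝ) : Bool × Bool :=
  pairIndicator (bundle (M.alloc (pairProfile Θ t s i w x b)) none) i

/-- The payment to the `t`-player, net of the cost of her tasks outside the `i`-th pair. -/
def pairPay (M : Mechanism (TwinPlayer n) (TwinTask n)) (Θ : ℝ) (t s : Fin (n - 1) → ℝ)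
    (i : Fin (n - 1)) (w : Bool × Bool → ℝ) (x b : ℝ) : ℝ :=
  M.pay (pairProfile Θ t s i w x b) none - ∑ j ∈ Finset.univ.erase i,
    pairCost (t j) 0 (t j)
      (pairIndicator (bundle (M.alloc (pairProfile Θ t s i w x b)) none) j)

theorem rootCost_update (t : Fin (n - 1) → ℝ) (i : Fin (n - 1)) (w : Bool × Bool → ℝ)
    (S : Finset (TwinTask n)) :
    rootCost (Function.update (fun j => pairCost (t j) 0 (t j)) i w) S =
      w (pairIndicator S i) +
        ∑ j ∈ Finset.univ.erase i, pairCost (t j) 0 (t j) (pairIndicator S j) := by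
  unfold rootCost
  rw [← Finset.add_sum_erase _ _ (Finset.mem_univ i), Function.update_self]
  congr 1
  refine Finset.sum_congr rfl fun j hj => ?_
  rw [Function.update_of_ne (Finset.ne_of_mem_erase hj)]

section Reduction

variable {Θ c : ℝ} {t s : Fin (n - 1) → ℝ} {i : Fin (n - 1)} {w : Bool × Bool → ℝ} {x b : ℝ}
  {M : Mechanism (TwinPlayer n) (TwinTask n)}

theorem isPairCost_update (ht : ∀ j, 0 ≤ t j) (hw : IsPairCost w) (j : Fin (n - 1)) :
    IsPairCost (Function.update (fun j => pairCost (t j) 0 (t j)) i w j) := by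
  rcases eq_or_ne j i with rfl | hj
  · simpa using hw
  · simpa [hj] using PairMechanism.isPairCost_first (ht j)

theorem update_nonneg {r : Fin (n - 1) → ℝ} (hr : ∀ j, 0 ≤ r j) (hx : 0 ≤ x)
    (j : Fin (n - 1)) : 0 ≤ Function.update r i x j := by
  rcases eq_or_ne j i with rfl | hj
  · simpa using hx
  · simpa [hj] using hr j

theorem pairProfile_inDomain (hΘ : 0 ≤ Θ) (ht : ∀ j, 0 ≤ t j)
    (hs : ∀ j, s j ∈ Set.Icc (0 : ℝ) 1) (hw : IsPairCost w) (hx : 0 ≤ x) (hb : 0 ≤ b) :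
    InDomain (twinDomain n Θ) (pairProfile Θ t s i w x b) :=
  twinProfile_inDomain hΘ (isPairCost_update ht hw) (update_nonneg (fun j => (hs j).1) hx)
    (update_nonneg (fun _ => n.cast_nonneg) hb)

/-- In every other pair the twin is free for the root and the first task costs its leaf at most `1`,
so these pairs do not matter for bounds `z ≥ 1`. -/
theorem optMakespan_pairProfile_le (hs : ∀ j, s j ∈ Set.Icc (0 : ℝ) 1) {z : ℝ} (hz : 1 ≤ z)
    (p : Bool × Bool) (hwp : w p ≤ z) (hp : leafCost x b p ≤ z) :
    optMakespan (pairProfile Θ t s i w x b) ≤ z := by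
  refine optMakespan_twinProfile_le (Function.update (fun _ => (false, true)) i p) ?_ fun j => ?_
  · rw [Finset.sum_eq_single i]
    · simpa using hwp
    · intro j _ hj
      simp [hj]
    · simp
  · rcases eq_or_ne j i with rfl | hj
    · simpa using hp
    · simpa [hj, leafCost] using (hs j).2.trans hz

theorem makespan_pairProfile_le (hΘ : 0 ≤ Θ) (ht : ∀ j, 0 ≤ t j)
    (hs : ∀ j, s j ∈ Set.Icc (0 : ℝ) 1) (hM : M.IsApprox (twinDomain n Θ) c)
    (hw : IsPairCost w) (hx : 0 ≤ x) (hb : 0 ≤ b) {z : ℝ} (hz : 1 ≤ z)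
    (p : Bool × Bool) (hwp : w p ≤ z) (hp : leafCost x b p ≤ z) :
    makespan (pairProfile Θ t s i w x b) (M.alloc (pairProfile Θ t s i w x b)) ≤
      max c 1 * z := by
  have h0 : 0 ≤ optMakespan (pairProfile Θ t s i w x b) :=
    optMakespan_nonneg (i := none) fun S => show 0 ≤ rootCost _ S from
      Finset.sum_nonneg fun j _ => (isPairCost_update ht hw j).nonneg _
  calc _ ≤ c * optMakespan (pairProfile Θ t s i w x b) :=
        hM _ (pairProfile_inDomain hΘ ht hs hw hx hb)
    _ ≤ max c 1 * optMakespan (pairProfile Θ t s i w x b) := by gcongr; exact le_max_left _ _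
    _ ≤ max c 1 * z := by
        gcongr
        exact optMakespan_pairProfile_le hs hz p hwp hp

theorem makespan_pairProfile_lt {B : ℝ} (hB : 1 ≤ B) (hΘ : max c 1 * B < Θ) (ht : ∀ j, 0 ≤ t j)
    (hs : ∀ j, s j ∈ Set.Icc (0 : ℝ) 1) (hM : M.IsApprox (twinDomain n Θ) c)
    (hw : IsPairCost w) (hx : 0 ≤ x) (hb : 0 ≤ b) (hxb : x + b ≤ B) :
    makespan (pairProfile Θ t s i w x b) (M.alloc (pairProfile Θ t s i w x b)) < Θ := by
  have hΘ0 : 0 ≤ Θ := by nlinarith [le_max_right c 1]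
  exact (makespan_pairProfile_le hΘ0 ht hs hM hw hx hb hB (false, false)
    (by rw [hw.none]; linarith) (by simpa [leafCost] using hxb)).trans_lt hΘ

theorem twinLeaf_bundle_pairProfile {B : ℝ} (hB : 1 ≤ B) (hΘ : max c 1 * B < Θ)
    (ht : ∀ j, 0 ≤ t j) (hs : ∀ j, s j ∈ Set.Icc (0 : ℝ) 1)
    (hM : M.IsApprox (twinDomain n Θ) c) (hw : IsPairCost w) (hx : 0 ≤ x) (hb : 0 ≤ b)
    (hxb : x + b ≤ B) (u v : ℝ) :
    twinLeaf Θ i u v (bundle (M.alloc (pairProfile Θ t s i w x b)) (some i)) =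
      leafCost u v (pairAlloc M Θ t s i w x b) :=
  twinLeaf_eq_leafCost_of_makespan_lt (by nlinarith [le_max_right c 1])
    (update_nonneg (fun j => (hs j).1) hx) (update_nonneg (fun _ => n.cast_nonneg) hb)
    (makespan_pairProfile_lt hB hΘ ht hs hM hw hx hb hxb) i u v

/-- The root's cost is additive across pairs and fixed outside pair `i`, so that part can be moved
into her payment. The leaf's cost depends on pair `i` only, since `Θ` exceeds the possible makespan.
-/
theorem pairMechanism {B : ℝ} (hB : 1 ≤ B) (hΘ : max c 1 * B < Θ) (ht : ∀ j, 0 ≤ t j)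
    (hs : ∀ j, s j ∈ Set.Icc (0 : ℝ) 1) (hT : M.IsTruthful (twinDomain n Θ))
    (hM : M.IsApprox (twinDomain n Θ) c) (i : Fin (n - 1)) :
    PairMechanism (max c 1) B (pairAlloc M Θ t s i) (pairPay M Θ t s i)
      (fun w x b => M.pay (pairProfile Θ t s i w x b) (some i)) := by
  have hΘ0 : 0 ≤ Θ := by nlinarith [le_max_right c 1]
  refine ⟨?_, ?_, ?_⟩
  · intro w w' x b hw hw' hx hb _
    have h := hT (pairProfile Θ t s i w x b) (pairProfile_inDomain hΘ0 ht hs hw hx hb) none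
      (rootCost (Function.update (fun j => pairCost (t j) 0 (t j)) i w'))
      (rootCost_mem (isPairCost_update ht hw') Θ)
    rw [show Function.update (pairProfile Θ t s i w x b) none (rootCost
      (Function.update (fun j => pairCost (t j) 0 (t j)) i w')) = pairProfile Θ t s i w' x b from
      update_twinProfile_none _ _ _ _ _] at h
    simp only [Mechanism.utility, show pairProfile Θ t s i w x b none =
      rootCost (Function.update (fun j => pairCost (t j) 0 (t j)) i w) from rfl,
      rootCost_update] at h
    simp only [pairPay, pairAlloc]
    linarith
  · intro w x b x' b' hw hx hb hxb hx' hb' hxb'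
    have h := hT (pairProfile Θ t s i w x b) (pairProfile_inDomain hΘ0 ht hs hw hx hb) (some i)
      (twinLeaf Θ i x' b') (twinLeaf_mem hΘ0 hx' hb' i)
    rw [show Function.update (pairProfile Θ t s i w x b) (some i) (twinLeaf Θ i x' b') =
      pairProfile Θ t s i w x' b' from update_twinProfile_some _ _ _ _ _ _ _ _ _] at h
    have hi : pairProfile Θ t s i w x b (some i) = twinLeaf Θ i x b := by
      simp [pairProfile, twinProfile]
    simp only [Mechanism.utility, hi] at h
    rwa [twinLeaf_bundle_pairProfile hB hΘ ht hs hM hw hx hb hxb,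
      twinLeaf_bundle_pairProfile hB hΘ ht hs hM hw hx' hb' hxb'] at h
  · intro w x b z p hw hx hb hxb hz hwp hp
    have h := makespan_pairProfile_le (i := i) hΘ0 ht hs hM hw hx hb hz p hwp hp
    constructor
    · refine le_trans ?_ ((le_makespan _ _ none).trans h)
      rw [show pairProfile Θ t s i w x b none =
        rootCost (Function.update (fun j => pairCost (t j) 0 (t j)) i w) from rfl,
        rootCost_update]
      exact le_add_of_nonneg_right (Finset.sum_nonneg fun j _ =>
        (PairMechanism.isPairCost_first (ht j)).nonneg _)
    · refine le_trans (le_of_eq ?_) ((le_makespan _ _ (some i)).trans h)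
      rw [show pairProfile Θ t s i w x b (some i) = twinLeaf Θ i x b by
        simp [pairProfile, twinProfile],
        twinLeaf_bundle_pairProfile hB hΘ ht hs hM hw hx hb hxb]

end Reduction

end TwinProfiles

/-! ### The theorem for all pairs -/

theorem mainTheorem5 (n : ℕ) (hn : 1 ≤ n) :
    ∃ Θ₀ : ℝ, ∀ Θ : ℝ, Θ₀ ≤ Θ →
      ∀ M : Mechanism (TwinPlayer n) (TwinTask n),
        M.IsTruthful (twinDomain n Θ) →
        (∃ c : ℝ, c < n ∧ M.IsApprox (twinDomain n Θ) c) →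
        IsLinearAlloc n Θ M.alloc := by
  obtain ⟨A, hA⟩ : ∃ A : ℝ, A = (n : ℝ) ^ 2 + 1 := ⟨_, rfl⟩
  obtain ⟨K, hK⟩ : ∃ K : ℝ, K = ((n : ℝ) + 2) * A := ⟨_, rfl⟩
  -- Leaf costs with `x + b ≤ K + A` keep the optimum at most `K + A`, so the makespan stays below
  -- `Θ`.
  refine ⟨n * (K + A), fun Θ hΘ M hT ⟨c, hcn, hM⟩ i => ?_⟩
  have hn2 : (2 : ℝ) ≤ n := by
    have := i.2
    exact_mod_cast (by omega : 2 ≤ n)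
  have hA1 : 1 ≤ A := by nlinarith
  have hB : 1 ≤ K + A := by nlinarith
  -- The existence of a pair `i` forces `n ≥ 2`, so the ratio may be raised to at least `1`.
  have hcn' : max c 1 < n := max_lt hcn (by linarith)
  have hΘ' : max c 1 * (K + A) < Θ := lt_of_lt_of_le (by gcongr) hΘ
  have key : ∀ σ ρ : {j : Fin (n - 1) // j ≠ i} → ℝ, ∃ lam gam : ℝ, 0 < lam ∧
      ∀ t s : Fin (n - 1) → ℝ, (∀ j, 0 ≤ t j) → (∀ j, s j ∈ Set.Icc (0 : ℝ) 1) →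
        dropCoord i s = σ → dropCoord i t = ρ →
        (t i < max 0 (lam * s i + gam) →
          M.alloc (restrictedInstance n Θ t s) (i, false) = none) ∧
        (max 0 (lam * s i + gam) < t i →
          M.alloc (restrictedInstance n Θ t s) (i, false) ≠ none) := by
    intro σ ρ
    by_cases hex : ∃ t s : Fin (n - 1) → ℝ, (∀ j, 0 ≤ t j) ∧ (∀ j, s j ∈ Set.Icc (0 : ℝ) 1) ∧
        dropCoord i s = σ ∧ dropCoord i t = ρ
    · obtain ⟨t, s, ht, hs, rfl, rfl⟩ := hex
      obtain ⟨lam, gam, hl, h⟩ := (pairMechanism hB hΘ' ht hs hT hM i).exists_linear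
        (le_max_right c 1) hcn' hA hK
      refine ⟨lam, gam, hl, fun t' s' ht' hs' hds hdt => ?_⟩
      rw [restrictedInstance_eq_pairProfile Θ t s t' s' i hdt hds]
      simpa [pairAlloc, pairIndicator, bundle] using h (t' i) (s' i) (ht' i) (hs' i).1 (hs' i).2
    -- No restricted instance has these remaining coordinates; the values are arbitrary.
    · exact ⟨1, 0, one_pos, fun t s ht hs h1 h2 => absurd ⟨t, s, ht, hs, h1, h2⟩ hex⟩
  choose lam gam hl h using key
  exact ⟨lam, gam, hl, fun t s ht hs => h _ _ t s ht hs rfl rfl⟩
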